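/- Let $X$ and $Y$ be measurable spaces, $D$ a probability distribution on $X\times Y$, and $G_1,\dots,G_K\subseteq X\times Y$ ($K\ge 1$) measurable, possibly overlapping groups with $D(G_i)>0$. Let $H$ be a nonempty class of measurable binary models $h:X\to\{0,1\}$ of finite VC dimension $d$, and let $L:\{0,1\}\times Y\to[0,1]$ be a loss function, measurable in $y$. As usual for uniform convergence over a possibly uncountable class, assume that for all $m$ and $b\in\{0,1\}^m$ the set of $(x_1,\dots,x_m)\in X^m$ for which some $h\in H$ satisfies $h(x_j)=b_j$ for all $j$ is measurable up to null sets of the $m$-fold product of the marginal of $D$ on $X$ (automatic if $H$ is countable). Let $S$ be a sample of $n$ independent draws from $D$, and let $n_i=n_i(S)$ be the number of its examples lying in $G_i$. Write $\epsilon_i(h)=\frac1{n_i}\sum_{(x,y)\in S,\ (x,y)\in G_i}L(h(x),y)$ and $\epsilon_i'(h)=\mathbb E_{(x,y)\sim D}[L(h(x),y)\mid (x,y)\in G_i]$. A randomized model is a probability distribution $q$ on $H$, on some $\sigma$-algebra for which $h\mapsto\nu(\{x:h(x)=1\})$ is measurable for every finite measure $\nu$ on $X$ (all finite and countable mixtures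 of members of $H$ are included); put $\epsilon_i(q)=\mathbb E_{h\sim q}\,\epsilon_i(h)$ and $\epsilon'_i(q)=\mathbb E_{h\sim q}\,\epsilon'_i(h)$, and let $\Delta H$ be the set of randomized models. There is an absolute constant $C>0$ such that, in every such situation and for every $0<\delta<1$: 1. For every group $i$, with probability at least $1-\delta$ over $S$, the following holds whenever $n_i\ge1$ and, in case $\delta>1/2$, also $d\ge1$ and $n_i\ge2$: simultaneously for all $h\in H$ and for all $h\in\Delta H$, $$|\epsilon_i(h)-\epsilon'_i(h)|\le C\sqrt{\frac{\log\frac1\delta+d\log n_i}{n_i}}.$$ 2. With probability at least $1-\delta$ over $S$, the following holds whenever $n_i\ge1$ for all $i$ and, in case $\delta>K/2$ (which can only happen for $K=1$), also $d\ge1$ and $n_i\ge 2$ for all $i$: for all $q\in\Delta H$, $$\Bigl|\max_i\epsilon_i(q)-\max_i\epsilon'_i(q)\Bigr|\le C\max_i\sqrt{\frac{\log\frac K\delta+d\log n_i}{n_i}},$$ and $$\Bigl|\inf_{q\in\Delta H}\max_i\epsilon_i(q)-\inf_{q\in\Delta H}\max_i\epsilon'_i(q)\Bigr|\le C\max_i\sqrt{\frac{\log\frac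 K\delta+d\log n_i}{n_i}}.$$ -/

import Mathlib

open MeasureTheory ProbabilityTheory

namespace GroupFair

universe u v

variable {X : Type u} {Y : Type v}

/-- A class `H` of binary models `X → {0,1}` shatters the finite set `A` if every subset `B` of `A`
is cut out on `A` by some member of `H`. -/
def Shatters (H : Set (X → Bool)) (A : Finset X) : Prop :=
  ∀ B : Finset X, B ⊆ A → ∃ h ∈ H, ∀ x ∈ A, h x = true ↔ x ∈ B

/-- The VC dimension: the supremum of the sizes of the finite sets shattered by `H`. -/
noncomputable def vcDim (H : Set (X → Bool)) : ℕ∞ :=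
  ⨆ (A : Finset X) (_ : Shatters H A), (A.card : ℕ∞)

/-- The usual measurability convention for uniform laws of large numbers over a possibly
uncountable class: for each `m` and each label pattern `b`, the set of `m`-tuples of points on
which some member of `H` realizes `b` is measurable up to null sets. It holds, for instance,
for every countable class of measurable models. -/
def TraceMeasurable [MeasurableSpace X] (H : Set (X → Bool)) (μ : Measure X) : Prop :=
  ∀ (m : ℕ) (b : Fin m → Bool),
    NullMeasurableSet {x : Fin m → X | ∃ h ∈ H, ∀ j, h (x j) = b j} (Measure.pi fun _ => μ)

open Classical in
/-- The indices of the examples of the sample `S` that belong to the group `G`. -/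
noncomputable def groupIndices {n : ℕ} (S : Fin n → X × Y) (G : Set (X × Y)) : Finset (Fin n) :=
  Finset.univ.filter fun j => S j ∈ G

/-- The sample size of the group `G` in the sample `S`. -/
noncomputable def groupSize {n : ℕ} (S : Fin n → X × Y) (G : Set (X × Y)) : ℕ :=
  (groupIndices S G).card

/-- The empirical error of the model `h` on the examples of the group `G` in the sample `S`. -/
noncomputable def empError (L : Bool → Y → ℝ) {n : ℕ} (S : Fin n → X × Y) (G : Set (X × Y))
    (h : X → Bool) : ℝ :=
  (1 / (groupSize S G : ℝ)) * ∑ j ∈ groupIndices S G, L (h (S j).1) (S j).2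

variable [MeasurableSpace X] [MeasurableSpace Y]

/-- The expected error of the model `h` under `D` conditioned on the group `G`. -/
noncomputable def condError (L : Bool → Y → ℝ) (D : Measure (X × Y)) (G : Set (X × Y))
    (h : X → Bool) : ℝ :=
  ∫ p, L (h p.1) p.2 ∂(cond D G)

/-- A randomized model: a probability distribution over `H`, on some σ-algebra for which the mass
`ν (h = 1)` depends measurably on `h`, for every finite measure `ν` (so that the errors of a random
member of `H` are random variables). With the σ-algebra of all subsets of `H` this comprises all
finite and countable mixtures of members of `H`. -/
structure RandomizedModel (H : Set (X → Bool)) where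
  sigma : MeasurableSpace H
  law : @Measure H sigma
  isProb : @IsProbabilityMeasure H sigma law
  measurable_mass : ∀ (ν : Measure X), IsFiniteMeasure ν →
    @Measurable H ENNReal sigma _ fun h : H => ν {x | h.1 x = true}

/-- The empirical group error of a randomized model: the expected error of a random choice. -/
noncomputable def RandomizedModel.empError {H : Set (X → Bool)} (q : RandomizedModel H)
    (L : Bool → Y → ℝ) {n : ℕ} (S : Fin n → X × Y) (G : Set (X × Y)) : ℝ :=
  @integral H ℝ _ _ q.sigma q.law fun h : H => GroupFair.empError L S G h.1

/-- The conditional group error of a randomized model: the expected error of a random choice. -/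
noncomputable def RandomizedModel.condError {H : Set (X → Bool)} (q : RandomizedModel H)
    (L : Bool → Y → ℝ) (D : Measure (X × Y)) (G : Set (X × Y)) : ℝ :=
  @integral H ℝ _ _ q.sigma q.law fun h : H => GroupFair.condError L D G h.1

/-- The in-sample minimax error over randomized models. -/
noncomputable def empMinimax (H : Set (X → Bool)) (L : Bool → Y → ℝ) {n K : ℕ}
    (S : Fin n → X × Y) (G : Fin K → Set (X × Y)) : ℝ :=
  ⨅ q : RandomizedModel H, ⨆ i : Fin K, q.empError L S (G i)

/-- The out-of-sample minimax error over randomized models. -/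
noncomputable def condMinimax (H : Set (X → Bool)) (L : Bool → Y → ℝ) {K : ℕ}
    (D : Measure (X × Y)) (G : Fin K → Set (X × Y)) : ℝ :=
  ⨅ q : RandomizedModel H, ⨆ i : Fin K, q.condError L D (G i)

/-- `P S` holds with probability at least `1 - δ` over a sample `S` of `n` independent draws from
`D`: the event contains a measurable event of that probability. -/
def WithHighProb (D : Measure (X × Y)) (n : ℕ) (δ : ℝ) (P : (Fin n → X × Y) → Prop) : Prop :=
  ∃ E : Set (Fin n → X × Y), MeasurableSet E ∧
    ENNReal.ofReal (1 - δ) ≤ Measure.pi (fun _ : Fin n => D) E ∧ ∀ S ∈ E, P S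

end GroupFair

/-! Given which examples lie in a group, those examples are independent draws from `D` conditioned
on the group. Part 1 thus reduces to the Vapnik–Chervonenkis bound for a sample of fixed size m,
applied to each index set separately. The law of total probability reassembles the bad events, so
the random size m costs no union bound (`measure_groupIndices_eq_inter`,
`exists_measurableSet_of_forall_groupIndices`).

The fixed-size bound is proved by symmetrization. If some h deviates on the sample, then by
Chebyshev an independent second sample stays near the mean with probability at least 1/2, so h has
different totals on the two samples. Swapping the members of any pairs preserves the law of the
double sample. Averaging over all swaps with the double sample fixed leaves only random signs:
Sauer–Shelah leaves at most (2m+1)^d label patterns, and Hoeffding bounds each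
(`measure_doubleDeviation_le`, `exists_measurableSet_uniform_deviation`).

A randomized model averages both errors under one law, so it inherits the uniform bound on the same
event. Part 2 spends confidence δ/K on each group. Maxima over groups and infima over models are
1-Lipschitz in the sup norm, so no minimax theorem is needed. -/

namespace GroupFair

/-! ### Sauer–Shelah for label patterns -/

/-- A polynomial bound on the sum of binomial coefficients in the Sauer–Shelah lemma. -/
theorem sum_choose_le (N d : ℕ) : ∑ k ∈ Finset.Iic d, N.choose k ≤ (N + 1) ^ d := by
  rw [add_pow, ← Nat.range_succ_eq_Iic]
  refine Finset.sum_le_sum fun k hk => ?_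
  have hk' : 0 < d.choose k := Nat.choose_pos (Nat.lt_succ_iff.1 (Finset.mem_range.1 hk))
  calc N.choose k ≤ N ^ k := Nat.choose_le_pow N k
    _ ≤ N ^ k * 1 ^ (d - k) * d.choose k := by
      simpa using Nat.le_mul_of_pos_right (N ^ k) hk'

open Classical in
/-- The label patterns that members of `H` realize on the family of points `x`. -/
noncomputable def traces {X ι : Type*} [Fintype ι] (H : Set (X → Bool)) (x : ι → X) :
    Finset (ι → Bool) :=
  Finset.univ.filter fun b => ∃ h ∈ H, ∀ j, h (x j) = b j

theorem mem_traces {X ι : Type*} [Fintype ι] {H : Set (X → Bool)} {x : ι → X} {b : ι → Bool} :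
    b ∈ traces H x ↔ ∃ h ∈ H, ∀ j, h (x j) = b j := by
  simp [traces]

/-- The Sauer–Shelah bound on the number of label patterns. -/
theorem card_traces_le {X ι : Type*} [Fintype ι] {H : Set (X → Bool)} {d : ℕ}
    (hd : vcDim H ≤ d) (x : ι → X) : (traces H x).card ≤ (Fintype.card ι + 1) ^ d := by
  classical
  let e : (ι → Bool) → Finset ι := fun b => Finset.univ.filter fun j => b j = true
  have he : Function.Injective e := by
    intro b b' hb
    funext j
    have : j ∈ e b ↔ j ∈ e b' := by rw [hb]
    simp only [e, Finset.mem_filter, Finset.mem_univ, true_and] at this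
    exact Bool.eq_iff_iff.2 this
  have hdim : ((traces H x).image e).vcDim ≤ d := by
    refine Finset.sup_le fun T hT => ?_
    rw [Finset.mem_shatterer] at hT
    have hcut : ∀ B ⊆ T, ∃ h ∈ H, ∀ j ∈ T, h (x j) = true ↔ j ∈ B := by
      intro B hB
      obtain ⟨u, hu, hTu⟩ := hT hB
      obtain ⟨b, hb, rfl⟩ := Finset.mem_image.1 hu
      obtain ⟨h, hh, hhb⟩ := mem_traces.1 hb
      refine ⟨h, hh, fun j hj => ?_⟩
      rw [← hTu]
      simp [e, hj, hhb]
    -- A model cutting out `{i}` separates i from every other index of T, so repeated points cannot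
    -- occur and the shattered set of points is as large as T.
    have hinj : Set.InjOn x T := by
      intro i hi j hj hij
      obtain ⟨h, -, hh⟩ := hcut {i} (by simpa using hi)
      have h1 := hh i hi
      have h2 := hh j hj
      rw [hij] at h1
      exact (Finset.mem_singleton.1 ((h2.symm.trans h1).2 (Finset.mem_singleton_self i))).symm
    have hsh : Shatters H (T.image x) := by
      intro B _
      obtain ⟨h, hh, hhB⟩ := hcut (T.filter fun j => x j ∈ B) (Finset.filter_subset _ _)
      refine ⟨h, hh, fun y hy => ?_⟩
      obtain ⟨j, hj, rfl⟩ := Finset.mem_image.1 hy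
      simp [hhB j hj, hj]
    have hle : ((T.image x).card : ℕ∞) ≤ d :=
      (le_iSup₂ (f := fun (A : Finset X) (_ : Shatters H A) => (A.card : ℕ∞))
        (T.image x) hsh).trans hd
    rw [Finset.card_image_of_injOn hinj] at hle
    exact_mod_cast hle
  calc (traces H x).card = ((traces H x).image e).card :=
        (Finset.card_image_of_injective _ he).symm
    _ ≤ _ := Finset.card_le_card_shatterer _
    _ ≤ _ := Finset.card_shatterer_le_sum_vcDim
    _ ≤ ∑ k ∈ Finset.Iic d, (Fintype.card ι).choose k :=
        Finset.sum_le_sum_of_subset (Finset.Iic_subset_Iic.2 hdim)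
    _ ≤ _ := sum_choose_le _ _

/-! ### Rademacher sums -/

/-- `c` with the sign prescribed by `b`. -/
def flipSign (b : Bool) (c : ℝ) : ℝ := if b then -c else c

theorem flipSign_neg (b : Bool) (c : ℝ) : flipSign b (-c) = -flipSign b c := by
  cases b <;> simp [flipSign]

/-- The signs are independent: the sum over sign vectors factors over coordinates, and each factor
is 2 cosh(r c) ≤ 2 exp(r²/2). -/
theorem sum_exp_signed_sum_le {ι : Type*} [Fintype ι] [DecidableEq ι] {c : ι → ℝ}
    (hc : ∀ j, |c j| ≤ 1) (r : ℝ) :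
    ∑ σ : ι → Bool, Real.exp (r * ∑ j, flipSign (σ j) (c j)) ≤
      2 ^ Fintype.card ι * Real.exp (Fintype.card ι * r ^ 2 / 2) := by
  have h1 : ∀ σ : ι → Bool, Real.exp (r * ∑ j, flipSign (σ j) (c j)) =
      ∏ j, Real.exp (r * flipSign (σ j) (c j)) := by
    intro σ
    rw [Finset.mul_sum, Real.exp_sum]
  have h2 : ∑ σ : ι → Bool, ∏ j, Real.exp (r * flipSign (σ j) (c j)) =
      ∏ j, ∑ b : Bool, Real.exp (r * flipSign b (c j)) := by
    rw [Finset.prod_univ_sum, Fintype.piFinset_univ]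
  have h3 : ∀ j, ∑ b : Bool, Real.exp (r * flipSign b (c j)) ≤ 2 * Real.exp (r ^ 2 / 2) := by
    intro j
    have hcosh := Real.cosh_le_exp_half_sq (r * c j)
    have hsq : c j ^ 2 ≤ 1 := (sq_le_one_iff_abs_le_one _).2 (hc j)
    have hexp : Real.exp ((r * c j) ^ 2 / 2) ≤ Real.exp (r ^ 2 / 2) := by
      apply Real.exp_le_exp.2
      rw [mul_pow]
      nlinarith [sq_nonneg r]
    rw [Real.cosh_eq] at hcosh
    simp only [Fintype.univ_bool, flipSign, Finset.sum_pair (by simp : true ≠ false), if_true,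
      Bool.false_eq_true, if_false, mul_neg]
    linarith
  calc _ = ∏ j, ∑ b : Bool, Real.exp (r * flipSign b (c j)) := by
        rw [← h2]; exact Finset.sum_congr rfl fun σ _ => h1 σ
    _ ≤ ∏ _j : ι, 2 * Real.exp (r ^ 2 / 2) :=
        Finset.prod_le_prod (fun j _ => Finset.sum_nonneg fun b _ => (Real.exp_pos _).le)
          fun j _ => h3 j
    _ = _ := by
        rw [Finset.prod_const, Finset.card_univ, mul_pow, ← Real.exp_nat_mul]
        ring_nf

theorem card_signed_sum_gt_le {ι : Type*} [Fintype ι] [DecidableEq ι] [Nonempty ι] {c : ι → ℝ}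
    (hc : ∀ j, |c j| ≤ 1) {s : ℝ} (hs : 0 ≤ s) :
    ((Finset.univ.filter fun σ : ι → Bool => s < ∑ j, flipSign (σ j) (c j)).card : ℝ) ≤
      2 ^ Fintype.card ι * Real.exp (-(s ^ 2 / (2 * Fintype.card ι))) := by
  have hm : (0 : ℝ) < Fintype.card ι := by exact_mod_cast Fintype.card_pos
  set m : ℝ := (Fintype.card ι : ℝ)
  -- The Chernoff parameter minimizing m r²/2 - r s.
  set r := s / m
  have hr : 0 ≤ r := div_nonneg hs hm.le
  have h1 : ((Finset.univ.filter fun σ : ι → Bool => s < ∑ j, flipSign (σ j) (c j)).card : ℝ) *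
      Real.exp (r * s) ≤ 2 ^ Fintype.card ι * Real.exp (m * r ^ 2 / 2) := by
    refine le_trans ?_ (sum_exp_signed_sum_le hc r)
    rw [← nsmul_eq_mul, ← Finset.sum_const]
    refine (Finset.sum_le_sum fun σ hσ => ?_).trans
      (Finset.sum_le_sum_of_subset_of_nonneg (Finset.filter_subset _ _)
        fun σ _ _ => (Real.exp_pos _).le)
    exact Real.exp_le_exp.2 (mul_le_mul_of_nonneg_left (Finset.mem_filter.1 hσ).2.le hr)
  have h2 : m * r ^ 2 / 2 = r * s + -(s ^ 2 / (2 * m)) := by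
    simp only [r]; field_simp; ring
  rw [h2, Real.exp_add, ← mul_assoc, mul_right_comm] at h1
  exact le_of_mul_le_mul_right h1 (Real.exp_pos _)

/-- Hoeffding's inequality for Rademacher sums, in counting form. -/
theorem card_abs_signed_sum_gt_le {ι : Type*} [Fintype ι] [DecidableEq ι] [Nonempty ι] {c : ι → ℝ}
    (hc : ∀ j, |c j| ≤ 1) {s : ℝ} (hs : 0 ≤ s) :
    ((Finset.univ.filter fun σ : ι → Bool => s < |∑ j, flipSign (σ j) (c j)|).card : ℝ) ≤
      2 ^ Fintype.card ι * (2 * Real.exp (-(s ^ 2 / (2 * Fintype.card ι)))) := by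
  have h1 := card_signed_sum_gt_le hc hs
  have h2 := card_signed_sum_gt_le (c := fun j => -c j) (by simpa using hc) hs
  simp only [flipSign_neg, Finset.sum_neg_distrib] at h2
  have hsub : (Finset.univ.filter fun σ : ι → Bool => s < |∑ j, flipSign (σ j) (c j)|) ⊆
      (Finset.univ.filter fun σ : ι → Bool => s < ∑ j, flipSign (σ j) (c j)) ∪
      (Finset.univ.filter fun σ : ι → Bool => s < -∑ j, flipSign (σ j) (c j)) := by
    intro σ hσ
    simpa [lt_abs] using hσ
  have h3 := (Finset.card_le_card hsub).trans (Finset.card_union_le _ _)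
  have h4 : ((Finset.univ.filter fun σ : ι → Bool => s < |∑ j, flipSign (σ j) (c j)|).card : ℝ) ≤
      (Finset.univ.filter fun σ : ι → Bool => s < ∑ j, flipSign (σ j) (c j)).card +
      (Finset.univ.filter fun σ : ι → Bool => s < -∑ j, flipSign (σ j) (c j)).card := by
    exact_mod_cast h3
  linarith

/-! ### Measurability of the double-sample event -/

/-- Trace measurability for families indexed by an arbitrary finite type. -/
theorem TraceMeasurable.nullMeasurableSet {X ι : Type*} [MeasurableSpace X] [Fintype ι]
    {H : Set (X → Bool)} {μ : Measure X} [SigmaFinite μ] (hH : TraceMeasurable H μ)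
    (b : ι → Bool) :
    NullMeasurableSet {x : ι → X | ∃ h ∈ H, ∀ j, h (x j) = b j} (Measure.pi fun _ => μ) := by
  let e := Fintype.equivFin ι
  have hmp := measurePreserving_piCongrLeft (fun _ : Fin (Fintype.card ι) => μ) e
  refine ((hH _ (b ∘ e.symm)).preimage hmp.quasiMeasurePreserving).congr
    (Filter.EventuallyEq.of_eq ?_)
  ext x
  have hx : ∀ j, (MeasurableEquiv.piCongrLeft (fun _ => X) e) x (e j) = x j := fun j =>
    MeasurableEquiv.piCongrLeft_apply_apply (β := fun _ => X) e x j
  constructor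
  · rintro ⟨h, hh, hb⟩
    refine ⟨h, hh, fun j => ?_⟩
    have := hb (e j)
    rw [hx j] at this
    simpa using this
  · rintro ⟨h, hh, hb⟩
    refine ⟨h, hh, fun j => ?_⟩
    obtain ⟨i, rfl⟩ := e.surjective j
    rw [hx i]
    simpa using hb i

/-- The points of `X` in a family of pairs of examples. -/
def pairPoints {X Y ι : Type*} (w : ι → (X × Y) × (X × Y)) : ι ⊕ ι → X :=
  Sum.elim (fun j => (w j).1.1) fun j => (w j).2.1

theorem measurePreserving_pairPoints {X Y ι : Type*} [MeasurableSpace X] [MeasurableSpace Y]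
    [Fintype ι] (P : Measure (X × Y)) [IsProbabilityMeasure P] :
    MeasurePreserving (pairPoints : (ι → (X × Y) × (X × Y)) → ι ⊕ ι → X)
      (Measure.pi fun _ => P.prod P) (Measure.pi fun _ => P.fst) := by
  have h1 := measurePreserving_arrowProdEquivProdArrow (X × Y) (X × Y) ι (fun _ => P) fun _ => P
  have h2 := measurePreserving_sumPiEquivProdPi_symm (X := fun _ : ι ⊕ ι => X × Y) fun _ => P
  have h3 := measurePreserving_pi (fun _ : ι ⊕ ι => P) (fun _ => P.fst)
    (f := fun _ => Prod.fst) fun _ => ⟨measurable_fst, rfl⟩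
  have h := h3.comp (h2.comp h1)
  convert h using 1
  funext w j
  cases j <;> rfl

/-- The event that some model has deviating total losses on the two halves of a double sample. -/
def doubleDeviation {X Y : Type*} (H : Set (X → Bool)) (L : Bool → Y → ℝ) (ι : Type*) [Fintype ι]
    (s : ℝ) : Set (ι → (X × Y) × (X × Y)) :=
  {w | ∃ h ∈ H, s < |∑ j, (L (h (w j).1.1) (w j).1.2 - L (h (w j).2.1) (w j).2.2)|}

/-- The class may be uncountable, but it induces finitely many patterns on the 2m points. For a
fixed pattern the deviation is a measurable condition on the labels in Y alone, and realizability of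
the pattern is null measurable by assumption. -/
theorem nullMeasurableSet_doubleDeviation {X Y ι : Type*} [MeasurableSpace X] [MeasurableSpace Y]
    [Fintype ι] {P : Measure (X × Y)} [IsProbabilityMeasure P] {H : Set (X → Bool)}
    (hH : TraceMeasurable H P.fst) {L : Bool → Y → ℝ} (hLm : ∀ a, Measurable (L a)) (s : ℝ) :
    NullMeasurableSet (doubleDeviation H L ι s) (Measure.pi fun _ => P.prod P) := by
  have key : doubleDeviation H L ι s = ⋃ b : ι ⊕ ι → Bool,
      pairPoints ⁻¹' {x | ∃ h ∈ H, ∀ j, h (x j) = b j} ∩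
      {w | s < |∑ j, (L (b (Sum.inl j)) (w j).1.2 - L (b (Sum.inr j)) (w j).2.2)|} := by
    ext w
    simp only [doubleDeviation, Set.mem_ofPred_eq, Set.mem_iUnion, Set.mem_inter_iff,
      Set.mem_preimage]
    constructor
    · rintro ⟨h, hh, hs⟩
      exact ⟨fun j => h (pairPoints w j), ⟨h, hh, fun _ => rfl⟩, hs⟩
    · rintro ⟨b, ⟨h, hh, hb⟩, hs⟩
      refine ⟨h, hh, ?_⟩
      simp only [← hb] at hs
      exact hs
  rw [key]
  refine NullMeasurableSet.iUnion fun b => NullMeasurableSet.inter ?_ ?_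
  · exact (hH.nullMeasurableSet b).preimage (measurePreserving_pairPoints P).quasiMeasurePreserving
  · refine MeasurableSet.nullMeasurableSet (measurableSet_lt measurable_const ?_)
    have : ∀ j : ι, Measurable fun w : ι → (X × Y) × (X × Y) =>
        L (b (Sum.inl j)) (w j).1.2 - L (b (Sum.inr j)) (w j).2.2 := fun j =>
      ((hLm _).comp (by fun_prop)).sub ((hLm _).comp (by fun_prop))
    exact (Finset.measurable_sum _ fun j _ => this j).abs

/-! ### Symmetrization by swapping pairs -/

/-- Swap the pairs marked by `σ`. -/
def swapPairs {Z ι : Type*} (σ : ι → Bool) (w : ι → Z × Z) : ι → Z × Z :=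
  fun j => if σ j then (w j).swap else w j

theorem measurePreserving_swapPairs {Z ι : Type*} [MeasurableSpace Z] [Fintype ι]
    (P : Measure Z) [IsProbabilityMeasure P] (σ : ι → Bool) :
    MeasurePreserving (swapPairs σ) (Measure.pi fun _ : ι => P.prod P)
      (Measure.pi fun _ => P.prod P) := by
  refine measurePreserving_pi (fun _ : ι => P.prod P) (fun _ => P.prod P)
    (f := fun j z => if σ j then z.swap else z) fun j => ?_
  cases σ j
  · simpa [Function.id_def] using MeasurePreserving.id (P.prod P)
  · simpa using Measure.measurePreserving_swap

-- Swaps permute the points of `w` and only flip signs of the loss differences. The models therefore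
-- enter through their patterns on the unswapped points, and a union bound over these patterns
-- applies.
open Classical in
theorem card_swapPairs_mem_doubleDeviation_le {X Y ι : Type*} [Fintype ι] [Nonempty ι]
    {H : Set (X → Bool)} {d : ℕ} (hd : vcDim H ≤ d) {L : Bool → Y → ℝ}
    (hL : ∀ a y, L a y ∈ Set.Icc (0 : ℝ) 1) {s : ℝ} (hs : 0 ≤ s)
    (w : ι → (X × Y) × (X × Y)) :
    ((Finset.univ.filter fun σ : ι → Bool => swapPairs σ w ∈ doubleDeviation H L ι s).card : ℝ) ≤
      2 ^ Fintype.card ι * ((2 * Fintype.card ι + 1) ^ d *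
        (2 * Real.exp (-(s ^ 2 / (2 * Fintype.card ι))))) := by
  let c : (ι ⊕ ι → Bool) → ι → ℝ := fun b j =>
    L (b (Sum.inl j)) (w j).1.2 - L (b (Sum.inr j)) (w j).2.2
  have hc : ∀ b j, |c b j| ≤ 1 := fun b j => by
    have h1 := hL (b (Sum.inl j)) (w j).1.2
    have h2 := hL (b (Sum.inr j)) (w j).2.2
    rw [abs_le]
    constructor <;> simp only [c] <;> linarith [h1.1, h1.2, h2.1, h2.2]
  have hsub : (Finset.univ.filter fun σ : ι → Bool =>
      swapPairs σ w ∈ doubleDeviation H L ι s) ⊆ (traces H (pairPoints w)).biUnion fun b =>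
        Finset.univ.filter fun σ : ι → Bool => s < |∑ j, flipSign (σ j) (c b j)| := by
    intro σ hσ
    obtain ⟨h, hh, hsum⟩ := (Finset.mem_filter.1 hσ).2
    refine Finset.mem_biUnion.2 ⟨fun j => h (pairPoints w j),
      mem_traces.2 ⟨h, hh, fun _ => rfl⟩, Finset.mem_filter.2 ⟨Finset.mem_univ _, ?_⟩⟩
    refine lt_of_lt_of_eq hsum (congrArg abs (Finset.sum_congr rfl fun j _ => ?_))
    cases hσj : σ j <;> simp [swapPairs, hσj, flipSign, c, pairPoints]
  have h1 := (Finset.card_le_card hsub).trans Finset.card_biUnion_le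
  have h2 : ((Finset.univ.filter fun σ : ι → Bool =>
      swapPairs σ w ∈ doubleDeviation H L ι s).card : ℝ) ≤
      ∑ b ∈ traces H (pairPoints w),
        ((Finset.univ.filter fun σ : ι → Bool => s < |∑ j, flipSign (σ j) (c b j)|).card : ℝ) := by
    exact_mod_cast h1
  have h3 : ((traces H (pairPoints w)).card : ℝ) ≤ (2 * Fintype.card ι + 1) ^ d := by
    have := card_traces_le hd (pairPoints w)
    rw [Fintype.card_sum, ← two_mul] at this
    exact_mod_cast this
  refine h2.trans ?_
  calc _ ≤ ∑ b ∈ traces H (pairPoints w), 2 ^ Fintype.card ι *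
        (2 * Real.exp (-(s ^ 2 / (2 * Fintype.card ι)))) :=
      Finset.sum_le_sum fun b _ => card_abs_signed_sum_gt_le (hc b) hs
    _ = (traces H (pairPoints w)).card * (2 ^ Fintype.card ι *
        (2 * Real.exp (-(s ^ 2 / (2 * Fintype.card ι))))) := by
      rw [Finset.sum_const, nsmul_eq_mul]
    _ ≤ (2 * Fintype.card ι + 1) ^ d * (2 ^ Fintype.card ι *
        (2 * Real.exp (-(s ^ 2 / (2 * Fintype.card ι))))) := by gcongr
    _ = _ := by ring

/-- Symmetrization: the double-sample deviation event has small probability. -/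
theorem measure_doubleDeviation_le {X Y ι : Type*} [MeasurableSpace X] [MeasurableSpace Y]
    [Fintype ι] [Nonempty ι] {P : Measure (X × Y)} [IsProbabilityMeasure P] {H : Set (X → Bool)}
    (hH : TraceMeasurable H P.fst) {d : ℕ} (hd : vcDim H ≤ d) {L : Bool → Y → ℝ}
    (hL : ∀ a y, L a y ∈ Set.Icc (0 : ℝ) 1) (hLm : ∀ a, Measurable (L a)) {s : ℝ} (hs : 0 ≤ s) :
    (Measure.pi fun _ : ι => P.prod P) (doubleDeviation H L ι s) ≤
      ENNReal.ofReal ((2 * Fintype.card ι + 1) ^ d *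
        (2 * Real.exp (-(s ^ 2 / (2 * Fintype.card ι))))) := by
  classical
  set μ := Measure.pi fun _ : ι => P.prod P
  set A := doubleDeviation H L ι s
  set c : ℝ := (2 * Fintype.card ι + 1) ^ d * (2 * Real.exp (-(s ^ 2 / (2 * Fintype.card ι))))
  have hA : NullMeasurableSet A μ := nullMeasurableSet_doubleDeviation hH hLm s
  have hpre : ∀ σ : ι → Bool, NullMeasurableSet (swapPairs σ ⁻¹' A) μ := fun σ =>
    hA.preimage (measurePreserving_swapPairs P σ).quasiMeasurePreserving
  have hmeas : ∀ σ : ι → Bool, ∫⁻ w, (swapPairs σ ⁻¹' A).indicator (fun _ => (1 : ENNReal)) w ∂μ = μ A := fun σ => by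
    rw [lintegral_indicator_const₀ (hpre σ), one_mul,
      (measurePreserving_swapPairs P σ).measure_preimage hA]
  -- Every swapped event has the measure of `A`, so the integral of the number of bad swaps is 2^m
  -- times that measure; the counting bound then holds pointwise.
  have hsum : (2 ^ Fintype.card ι : ENNReal) * μ A =
      ∫⁻ w, ∑ σ : ι → Bool, (swapPairs σ ⁻¹' A).indicator (fun _ => (1 : ENNReal)) w ∂μ := by
    rw [lintegral_finsetSum' _ fun σ _ => aemeasurable_const.indicator₀ (hpre σ)]
    simp [hmeas]
  have hpt : ∀ w, ∑ σ : ι → Bool, (swapPairs σ ⁻¹' A).indicator (fun _ => (1 : ENNReal)) w ≤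
      2 ^ Fintype.card ι * ENNReal.ofReal c := by
    intro w
    have h1 : ∑ σ : ι → Bool, (swapPairs σ ⁻¹' A).indicator (fun _ => (1 : ENNReal)) w =
        ((Finset.univ.filter fun σ : ι → Bool => swapPairs σ w ∈ A).card : ENNReal) := by
      simp [Set.indicator_apply, Finset.sum_boole]
    rw [h1, ← ENNReal.ofReal_natCast]
    refine (ENNReal.ofReal_le_ofReal
      (card_swapPairs_mem_doubleDeviation_le hd hL hs w)).trans_eq ?_
    rw [ENNReal.ofReal_mul (by positivity), ENNReal.ofReal_pow (by norm_num), ENNReal.ofReal_ofNat]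
  have hle : (2 ^ Fintype.card ι : ENNReal) * μ A ≤ 2 ^ Fintype.card ι * ENNReal.ofReal c := by
    rw [hsum]
    refine (lintegral_mono hpt).trans_eq ?_
    simp [μ]
  exact (ENNReal.mul_le_mul_iff_right (by positivity) (by finiteness)).1 hle

/-! ### The second sample and the Vapnik–Chervonenkis inequality -/

/-- Chebyshev's inequality for the total of a function with values in `[0, 1]`. -/
theorem half_le_measure_pi_abs_sum_sub_lt {Z ι : Type*} [MeasurableSpace Z] [Fintype ι]
    {P : Measure Z} [IsProbabilityMeasure P] {f : Z → ℝ} (hf : Measurable f)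
    (hf01 : ∀ z, f z ∈ Set.Icc (0 : ℝ) 1) {r : ℝ} (hr : 0 < r)
    (hm : Fintype.card ι ≤ 2 * r ^ 2) :
    2⁻¹ ≤ (Measure.pi fun _ : ι => P)
      {z | |∑ j, f (z j) - Fintype.card ι * ∫ z, f z ∂P| < r} := by
  set μ := Measure.pi fun _ : ι => P
  have hL2 : MemLp f 2 P :=
    memLp_of_bounded (ae_of_all _ hf01) hf.aestronglyMeasurable 2
  have hint : Integrable f P := hL2.integrable (by norm_num)
  have hcoord : ∀ j : ι, MemLp (fun z : ι → Z => f (z j)) 2 μ := fun j =>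
    hL2.comp_measurePreserving (measurePreserving_eval _ j)
  have hS : MemLp (∑ j, fun z : ι → Z => f (z j)) 2 μ := memLp_finsetSum' _ fun j _ => hcoord j
  have hmean : ∫ z, (∑ j, fun z : ι → Z => f (z j)) z ∂μ =
      Fintype.card ι * ∫ z, f z ∂P := by
    simp only [Finset.sum_apply]
    rw [integral_finsetSum _ fun j _ => (hcoord j).integrable (by norm_num)]
    have : ∀ j : ι, ∫ z : ι → Z, f (z j) ∂μ = ∫ z, f z ∂P := fun j =>
      integral_comp_eval (μ := fun _ : ι => P) hf.aestronglyMeasurable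
    simp [this]
  -- Values in an interval of length 1 have variance at most 1/4; with m ≤ 2r² the Chebyshev ratio
  -- is then at most 1/2.
  have hvar : Var[∑ j, fun z : ι → Z => f (z j); μ] ≤ Fintype.card ι / 4 := by
    rw [variance_sum_pi fun _ => hL2]
    have := variance_le_sq_of_bounded (ae_of_all P hf01) hf.aemeasurable
    rw [Finset.sum_const, nsmul_eq_mul, Finset.card_univ]
    nlinarith [(Nat.cast_nonneg (Fintype.card ι) : (0 : ℝ) ≤ _)]
  have hcheb := meas_ge_le_variance_div_sq hS hr
  rw [hmean] at hcheb
  have hhalf : μ {z | r ≤ |∑ j, f (z j) - Fintype.card ι * ∫ z, f z ∂P|} ≤ 1 / 2 := by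
    simp only [Finset.sum_apply] at hcheb
    refine hcheb.trans ?_
    have : Var[∑ j, fun z : ι → Z => f (z j); μ] / r ^ 2 ≤ 1 / 2 := by
      rw [div_le_iff₀ (by positivity)]
      linarith
    refine (ENNReal.ofReal_le_ofReal this).trans_eq ?_
    rw [ENNReal.ofReal_div_of_pos two_pos]
    simp
  have hmeas : MeasurableSet {z : ι → Z | r ≤ |∑ j, f (z j) - Fintype.card ι * ∫ z, f z ∂P|} :=
    measurableSet_le measurable_const
      ((Finset.measurable_sum _ fun j _ => hf.comp (measurable_pi_apply j)).sub_const _).abs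
  have hcompl : {z : ι → Z | |∑ j, f (z j) - Fintype.card ι * ∫ z, f z ∂P| < r} =
      {z : ι → Z | r ≤ |∑ j, f (z j) - Fintype.card ι * ∫ z, f z ∂P|}ᶜ := by
    ext z; simp
  rw [hcompl, prob_compl_eq_one_sub hmeas]
  refine le_trans ?_ (tsub_le_tsub_left hhalf 1)
  rw [one_div, ENNReal.one_sub_inv_two]

/-- The Vapnik–Chervonenkis inequality: outside a measurable event of small probability, all
members of `H` have total losses close to their expectation. -/
theorem exists_measurableSet_uniform_deviation {X Y ι : Type*} [MeasurableSpace X]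
    [MeasurableSpace Y] [Fintype ι] [Nonempty ι] {P : Measure (X × Y)} [IsProbabilityMeasure P]
    {H : Set (X → Bool)} (hHm : ∀ h ∈ H, Measurable h) (hH : TraceMeasurable H P.fst) {d : ℕ}
    (hd : vcDim H ≤ d) {L : Bool → Y → ℝ} (hL : ∀ a y, L a y ∈ Set.Icc (0 : ℝ) 1)
    (hLm : ∀ a, Measurable (L a)) {r : ℝ} (hr : 0 < r) (hm : Fintype.card ι ≤ 2 * r ^ 2) :
    ∃ B : Set (ι → X × Y), MeasurableSet B ∧
      (Measure.pi fun _ => P) B ≤ ENNReal.ofReal (4 * (2 * Fintype.card ι + 1) ^ d *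
        Real.exp (-(r ^ 2 / (2 * Fintype.card ι)))) ∧
      ∀ z ∉ B, ∀ h ∈ H, |∑ j, L (h (z j).1) (z j).2 -
        Fintype.card ι * ∫ p, L (h p.1) p.2 ∂P| ≤ 2 * r := by
  classical
  set μ := Measure.pi fun _ : ι => P
  let e := MeasurableEquiv.arrowProdEquivProdArrow (X × Y) (X × Y) ι
  have he : MeasurePreserving e (Measure.pi fun _ => P.prod P) (μ.prod μ) :=
    measurePreserving_arrowProdEquivProdArrow (X × Y) (X × Y) ι (fun _ => P) fun _ => P
  let A : Set ((ι → X × Y) × (ι → X × Y)) := e.symm ⁻¹' doubleDeviation H L ι r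
  have hA : (μ.prod μ) A = (Measure.pi fun _ => P.prod P) (doubleDeviation H L ι r) :=
    he.symm.measure_preimage_equiv _
  -- A measurable hull of the same measure makes sections measurable. The bad set consists of the
  -- samples whose section has measure at least 1/2, so by Markov its measure is at most twice that
  -- of `A`.
  let M := toMeasurable (μ.prod μ) A
  have hM : MeasurableSet M := measurableSet_toMeasurable _ _
  refine ⟨{z | 2⁻¹ ≤ μ (Prod.mk z ⁻¹' M)},
    measurableSet_le measurable_const (measurable_measure_prodMk_left hM), ?_, ?_⟩
  · have h1 := mul_meas_ge_le_lintegral (μ := μ) (measurable_measure_prodMk_left (ν := μ) hM) 2⁻¹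
    rw [← Measure.prod_apply hM, measure_toMeasurable, hA] at h1
    have h2 := h1.trans (measure_doubleDeviation_le hH hd hL hLm hr.le)
    rw [ ← ENNReal.div_eq_inv_mul, ENNReal.div_le_iff (by norm_num) (by norm_num)] at h2
    refine h2.trans_eq ?_
    rw [← ENNReal.ofReal_ofNat, ← ENNReal.ofReal_mul (by positivity)]
    congr 1
    ring
  · intro z hz h hh
    by_contra! hcon
    refine hz ?_
    have hf : Measurable fun p : X × Y => L (h p.1) p.2 := by
      have : (fun p : X × Y => L (h p.1) p.2) =
          fun p => if h p.1 = true then L true p.2 else L false p.2 := by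
        funext p; cases h p.1 <;> rfl
      rw [this]
      refine Measurable.ite ?_ ((hLm _).comp measurable_snd) ((hLm _).comp measurable_snd)
      exact ((hHm h hh).comp measurable_fst) (measurableSet_singleton true)
    -- A deviation above 2r on `z` and below r on `z'` separates the two totals by more than r.
    refine (half_le_measure_pi_abs_sum_sub_lt (ι := ι) (P := P) hf (fun p => hL _ _) hr hm).trans
      (measure_mono fun z' hz' => subset_toMeasurable _ _ ⟨h, hh, ?_⟩)
    change r < |∑ j, (L (h (z j).1) (z j).2 - L (h (z' j).1) (z' j).2)|
    rw [Finset.sum_sub_distrib]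
    have := abs_sub_abs_le_abs_sub (∑ j, L (h (z j).1) (z j).2 -
        Fintype.card ι * ∫ p, L (h p.1) p.2 ∂P) (∑ j, L (h (z' j).1) (z' j).2 -
        Fintype.card ι * ∫ p, L (h p.1) p.2 ∂P)
    rw [sub_sub_sub_cancel_right] at this
    simp only [Set.mem_ofPred_eq] at hz'
    linarith

/-- The Vapnik–Chervonenkis bound with confidence `1 - δ` for a sample indexed by `ι`. -/
theorem exists_measurableSet_average_deviation {X Y ι : Type*} [MeasurableSpace X]
    [MeasurableSpace Y] [Fintype ι] {P : Measure (X × Y)} [IsProbabilityMeasure P]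
    {H : Set (X → Bool)} (hHm : ∀ h ∈ H, Measurable h) (hH : TraceMeasurable H P.fst) {d : ℕ}
    (hd : vcDim H ≤ d) {L : Bool → Y → ℝ} (hL : ∀ a y, L a y ∈ Set.Icc (0 : ℝ) 1)
    (hLm : ∀ a, Measurable (L a)) {δ : ℝ} (hδ0 : 0 < δ) (hδ1 : δ < 1) {m : ℕ}
    (hm : Fintype.card ι = m) :
    ∃ B : Set (ι → X × Y), MeasurableSet B ∧ (Measure.pi fun _ => P) B ≤ ENNReal.ofReal δ ∧
      ∀ z ∉ B, 1 ≤ m → (δ ≤ 1 / 2 ∨ (1 ≤ d ∧ 2 ≤ m)) → ∀ h ∈ H,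
        |1 / (m : ℝ) * ∑ j, L (h (z j).1) (z j).2 - ∫ p, L (h p.1) p.2 ∂P| ≤
          8 * Real.sqrt ((Real.log (1 / δ) + d * Real.log m) / m) := by
  by_cases hcond : 1 ≤ m ∧ (δ ≤ 1 / 2 ∨ (1 ≤ d ∧ 2 ≤ m))
  swap
  · exact ⟨∅, MeasurableSet.empty, by simp, fun z _ h1 h2 => absurd ⟨h1, h2⟩ hcond⟩
  obtain ⟨hm1, hor⟩ := hcond
  have hm0 : (0 : ℝ) < m := by exact_mod_cast hm1
  have hlogm : 0 ≤ d * Real.log m :=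
    mul_nonneg (Nat.cast_nonneg d) (Real.log_nonneg (by exact_mod_cast hm1))
  have hlogδ : 0 < Real.log (1 / δ) := Real.log_pos (by rwa [lt_div_iff₀ hδ0, one_mul])
  set Λ := Real.log (1 / δ) + d * Real.log m
  have hlog2 : (0.69 : ℝ) < Real.log 2 := by linarith [Real.log_two_gt_d9]
  -- The only use of the side condition: either log(1/δ) or d log m already reaches log 2, so
  -- numerical constants can be absorbed into Λ.
  have hΛ : Real.log 2 ≤ Λ := by
    rcases hor with h | ⟨h1, h2⟩
    · have : Real.log 2 ≤ Real.log (1 / δ) :=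
        Real.log_le_log two_pos (by rw [le_div_iff₀ hδ0]; linarith)
      linarith
    · have h3 : Real.log 2 ≤ Real.log m := Real.log_le_log two_pos (by exact_mod_cast h2)
      have h4 : (1 : ℝ) ≤ d := by exact_mod_cast h1
      nlinarith
  -- For m = 1, log m vanishes and cannot absorb the pattern count; but the bound is then at least
  -- 4, while errors lie in [0,1].
  rcases Nat.lt_or_ge m 2 with hm2 | hm2
  · have hm_one : m = 1 := by omega
    subst hm_one
    refine ⟨∅, MeasurableSet.empty, by simp, fun z _ _ _ h hh => ?_⟩
    have hs : (1 / 2 : ℝ) ≤ Real.sqrt (Λ / (1 : ℕ)) := by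
      apply Real.le_sqrt_of_sq_le
      simp only [Nat.cast_one, div_one]
      linarith
    obtain ⟨j, hj⟩ := Fintype.card_eq_one_iff.1 hm
    have hsum : ∑ j, L (h (z j).1) (z j).2 = L (h (z j).1) (z j).2 :=
      Fintype.sum_eq_single j fun i hi => absurd (hj i) hi
    have h1 := hL (h (z j).1) (z j).2
    have h2 : 0 ≤ ∫ p, L (h p.1) p.2 ∂P := integral_nonneg fun p => (hL _ _).1
    have h3 : ∫ p, L (h p.1) p.2 ∂P ≤ 1 := by
      refine (integral_mono_of_nonneg (ae_of_all _ fun p => (hL _ _).1) (integrable_const 1)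
        (ae_of_all _ fun p => (hL _ _).2)).trans_eq ?_
      simp
    rw [hsum, Nat.cast_one, div_one, one_mul]
    rw [Nat.cast_one] at hs
    rw [abs_le]
    constructor <;> linarith [h1.1, h1.2]
  · have : Nonempty ι := Fintype.card_pos_iff.1 (by omega)
    have hΛ0 : 0 < Λ := by linarith
    -- This makes the exponent r²/(2m) equal to 8Λ. The factor 4 costs 2 log 2 ≤ 2Λ, the patterns
    -- cost 3 d log m ≤ 3Λ since 2m+1 ≤ m³ for m ≥ 2, and δ costs log(1/δ) ≤ Λ. The deviation 2r/m
    -- is 8√(Λ/m).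
    set r := 4 * Real.sqrt (m * Λ)
    have hr : 0 < r := by positivity
    have hr2 : r ^ 2 = 16 * (m * Λ) := by
      rw [mul_pow, Real.sq_sqrt (by positivity)]; norm_num
    obtain ⟨B, hB, hPB, hdev⟩ := exists_measurableSet_uniform_deviation (ι := ι) hHm hH hd hL hLm hr
      (by rw [hr2, hm]; nlinarith)
    refine ⟨B, hB, hPB.trans (ENNReal.ofReal_le_ofReal ?_), fun z hz _ _ h hh => ?_⟩
    · rw [hm, hr2]
      have hexp : 16 * (m * Λ) / (2 * m) = 8 * Λ := by field_simp; ring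
      rw [hexp]
      have h4 : (4 : ℝ) = Real.exp (2 * Real.log 2) := by
        rw [two_mul, Real.exp_add, Real.exp_log two_pos]; norm_num
      have hcube : ((2 * m + 1 : ℝ)) ^ d ≤ Real.exp (3 * (d * Real.log m)) := by
        have h5 : (2 * m + 1 : ℝ) ≤ (m : ℝ) ^ 3 := by
          have : (2 : ℝ) ≤ m := by exact_mod_cast hm2
          nlinarith [mul_self_nonneg ((m : ℝ) - 2), mul_pos hm0 hm0]
        calc ((2 * m + 1 : ℝ)) ^ d ≤ ((m : ℝ) ^ 3) ^ d := by gcongr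
          _ = Real.exp (3 * (d * Real.log m)) := by
            rw [← Real.exp_log hm0, ← Real.exp_nat_mul, ← Real.exp_nat_mul, Real.log_exp]
            push_cast; ring_nf
      have hδe : δ = Real.exp (-Real.log (1 / δ)) := by
        rw [one_div, Real.log_inv, neg_neg, Real.exp_log hδ0]
      calc 4 * (2 * (m : ℝ) + 1) ^ d * Real.exp (-(8 * Λ))
          ≤ Real.exp (2 * Real.log 2) * Real.exp (3 * (d * Real.log m)) * Real.exp (-(8 * Λ)) := by
            rw [← h4]; gcongr
        _ = Real.exp (2 * Real.log 2 + 3 * (d * Real.log m) + -(8 * Λ)) := by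
            rw [Real.exp_add, Real.exp_add]
        _ ≤ Real.exp (-Real.log (1 / δ)) := by
            apply Real.exp_le_exp.2
            simp only [Λ] at hΛ ⊢
            linarith
        _ = δ := hδe.symm
    · have h1 := hdev z hz h hh
      rw [hm] at h1
      have h2 : 1 / (m : ℝ) * ∑ j, L (h (z j).1) (z j).2 - ∫ p, L (h p.1) p.2 ∂P =
          (∑ j, L (h (z j).1) (z j).2 - m * ∫ p, L (h p.1) p.2 ∂P) / m := by
        field_simp
      rw [h2, abs_div, abs_of_pos hm0, div_le_iff₀ hm0]
      refine h1.trans_eq ?_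
      have h3 : Real.sqrt (m * Λ) = Real.sqrt (Λ / m) * m := by
        have : (m : ℝ) * Λ = Λ / m * m ^ 2 := by field_simp
        rw [this, Real.sqrt_mul (by positivity), Real.sqrt_sq hm0.le]
      simp only [r]
      rw [h3]; ring

/-! ### Conditioning on the group's index set -/

/-- The product of conditioned measures is the product measure conditioned on a box. -/
theorem pi_cond {Z ι : Type*} [MeasurableSpace Z] [Fintype ι] (D : Measure Z)
    [IsProbabilityMeasure D] {G : Set Z} (hG : MeasurableSet G) (hG0 : D G ≠ 0) :
    (Measure.pi fun _ : ι => cond D G) =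
      cond (Measure.pi fun _ : ι => D) (Set.univ.pi fun _ => G) := by
  have : IsProbabilityMeasure (cond D G) := cond_isProbabilityMeasure hG0
  refine Measure.pi_eq fun s _ => ?_
  rw [cond_apply (MeasurableSet.univ_pi fun _ => hG), ← Set.pi_inter_distrib, Measure.pi_pi,
    Measure.pi_pi]
  simp_rw [cond_apply hG]
  rw [Finset.prod_mul_distrib, ENNReal.prod_inv_distrib]
  exact fun _ _ _ _ _ => Or.inl hG0

/-- Conditioning only shrinks null sets: powers of the conditioned law are absolutely continuous
with respect to powers of `D`, and this passes to the marginals on X. -/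
theorem TraceMeasurable.cond {X Y : Type*} [MeasurableSpace X] [MeasurableSpace Y]
    {D : Measure (X × Y)} [IsProbabilityMeasure D] {H : Set (X → Bool)}
    (hH : TraceMeasurable H D.fst) {G : Set (X × Y)} (hG : MeasurableSet G) (hG0 : D G ≠ 0) :
    TraceMeasurable H (ProbabilityTheory.cond D G).fst := by
  intro m b
  have : IsProbabilityMeasure (ProbabilityTheory.cond D G) := cond_isProbabilityMeasure hG0
  have hmp : ∀ (P : Measure (X × Y)) [IsProbabilityMeasure P],
      MeasurePreserving (fun (z : Fin m → X × Y) j => (z j).1) (Measure.pi fun _ => P)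
        (Measure.pi fun _ => P.fst) := fun P _ =>
    measurePreserving_pi (fun _ => P) (fun _ => P.fst) (f := fun _ => Prod.fst)
      fun _ => ⟨measurable_fst, rfl⟩
  refine (hH m b).mono_ac ?_
  rw [← (hmp D).map_eq, ← (hmp (ProbabilityTheory.cond D G)).map_eq]
  refine Measure.AbsolutelyContinuous.map ?_ (hmp D).measurable
  rw [pi_cond D hG hG0]
  exact cond_absolutelyContinuous

theorem mem_groupIndices {X Y : Type*} {n : ℕ} {S : Fin n → X × Y} {G : Set (X × Y)} {j : Fin n} :
    j ∈ groupIndices S G ↔ S j ∈ G := by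
  simp [groupIndices]

/-- Conditionally on the index set of the group, its examples are independent draws from the
conditioned distribution. -/
theorem measure_groupIndices_eq_inter {X Y : Type*} [MeasurableSpace X] [MeasurableSpace Y]
    (D : Measure (X × Y)) [IsProbabilityMeasure D] {G : Set (X × Y)} (hG : MeasurableSet G)
    (hG0 : D G ≠ 0) {n : ℕ} (J : Finset (Fin n)) (B : Set (J → X × Y)) :
    (Measure.pi fun _ : Fin n => D) {S | groupIndices S G = J ∧ (fun j : J => S j) ∈ B} =
      (Measure.pi fun _ : J => cond D G) B *
        (Measure.pi fun _ : Fin n => D) {S | groupIndices S G = J} := by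
  classical
  have hmp := measurePreserving_piEquivPiSubtypeProd (fun _ : Fin n => D) (· ∈ J)
  -- Splitting the coordinates along J turns the event into a product: a condition on the examples
  -- in J, times the requirement that all others avoid the group.
  have hset : ∀ B : Set (J → X × Y),
      {S : Fin n → X × Y | groupIndices S G = J ∧ (fun j : J => S j) ∈ B} =
      MeasurableEquiv.piEquivPiSubtypeProd (fun _ => X × Y) (· ∈ J) ⁻¹'
        (((Set.univ.pi fun _ => G) ∩ B) ×ˢ (Set.univ.pi fun _ => Gᶜ)) := by
    intro B
    ext S
    have hiff : groupIndices S G = J ↔ (∀ j ∈ J, S j ∈ G) ∧ ∀ j, j ∉ J → S j ∉ G := by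
      constructor
      · rintro rfl
        exact ⟨fun j hj => mem_groupIndices.1 hj, fun j hj hj' => hj (mem_groupIndices.2 hj')⟩
      · rintro ⟨h1, h2⟩
        ext j
        rw [mem_groupIndices]
        exact ⟨fun hj => by_contra fun hj' => h2 j hj' hj, h1 j⟩
    have hB : ((fun j : J => S j) ∈ B) ↔
        (MeasurableEquiv.piEquivPiSubtypeProd (fun _ => X × Y) (· ∈ J) S).1 ∈ B := Iff.rfl
    simp only [Set.mem_ofPred_eq, Set.mem_preimage, Set.mem_prod, Set.mem_inter_iff, Set.mem_pi,
      Set.mem_univ, true_imp_iff, ← hB, hiff, Subtype.forall, Set.mem_compl_iff]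
    exact and_right_comm
  have hval : ∀ B : Set (J → X × Y), (Measure.pi fun _ : Fin n => D)
      {S : Fin n → X × Y | groupIndices S G = J ∧ (fun j : J => S j) ∈ B} =
      (Measure.pi fun _ : J => D) ((Set.univ.pi fun _ => G) ∩ B) *
        (Measure.pi fun _ : {j // j ∉ J} => D) (Set.univ.pi fun _ => Gᶜ) := by
    intro B
    rw [hset, hmp.measure_preimage_equiv, Measure.prod_prod]
    congr!
  have huniv := hval Set.univ
  simp only [Set.mem_univ, and_true, Set.inter_univ] at huniv
  rw [hval, huniv, pi_cond D hG hG0, ← mul_assoc,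
    cond_mul_eq_inter (MeasurableSet.univ_pi fun _ => hG)]

theorem measurableSet_groupIndices_eq {X Y : Type*} [MeasurableSpace X] [MeasurableSpace Y]
    {G : Set (X × Y)} (hG : MeasurableSet G) {n : ℕ} (J : Finset (Fin n)) :
    MeasurableSet {S : Fin n → X × Y | groupIndices S G = J} := by
  have : {S : Fin n → X × Y | groupIndices S G = J} = ⋂ j, {S | S j ∈ G ↔ j ∈ J} := by
    ext S
    simp [Finset.ext_iff, mem_groupIndices]
  rw [this]
  refine MeasurableSet.iInter fun j => ?_
  by_cases hj : j ∈ J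
  · simp only [hj, iff_true]
    exact (measurable_pi_apply j : Measurable fun S : Fin n → X × Y => S j) hG
  · simp only [hj, iff_false]
    exact (measurable_pi_apply j : Measurable fun S : Fin n → X × Y => S j) hG.compl

/-- An event of conditional probability at most `ε` given each index set of the group has
probability at most `ε`. -/
theorem exists_measurableSet_of_forall_groupIndices {X Y : Type*} [MeasurableSpace X]
    [MeasurableSpace Y] (D : Measure (X × Y)) [IsProbabilityMeasure D] {G : Set (X × Y)}
    (hG : MeasurableSet G) (hG0 : D G ≠ 0) {n : ℕ} {ε : ENNReal}
    (B : ∀ J : Finset (Fin n), Set (J → X × Y)) (hB : ∀ J, MeasurableSet (B J))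
    (hε : ∀ J : Finset (Fin n), (Measure.pi fun _ : J => cond D G) (B J) ≤ ε) :
    ∃ A : Set (Fin n → X × Y), MeasurableSet A ∧ (Measure.pi fun _ => D) A ≤ ε ∧
      ∀ S ∉ A, (fun j : groupIndices S G => S j) ∉ B (groupIndices S G) := by
  refine ⟨⋃ J, {S | groupIndices S G = J ∧ (fun j : J => S j) ∈ B J}, ?_, ?_, ?_⟩
  · refine MeasurableSet.iUnion fun J => (measurableSet_groupIndices_eq hG J).inter ?_
    exact (measurable_pi_lambda _ fun j => measurable_pi_apply _) (hB J)
  -- Total probability: the events indexed by J partition the sample space, so their weights sum to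
  -- 1.
  · refine (measure_iUnion_fintype_le _ _).trans ?_
    calc _ ≤ ∑ J : Finset (Fin n), ε *
          (Measure.pi fun _ : Fin n => D) {S | groupIndices S G = J} :=
        Finset.sum_le_sum fun J _ => by
          rw [measure_groupIndices_eq_inter D hG hG0]
          gcongr
          exact hε J
      _ = ε * ∑ J : Finset (Fin n), (Measure.pi fun _ : Fin n => D)
          ((fun S => groupIndices S G) ⁻¹' {J}) := by rw [Finset.mul_sum]; rfl
      _ = ε := by
        rw [sum_measure_preimage_singleton _ fun J _ => measurableSet_groupIndices_eq hG J]
        simp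
  · intro S hS hmem
    exact hS (Set.mem_iUnion.2 ⟨groupIndices S G, rfl, hmem⟩)

/-- Uniform convergence on one group over deterministic models. -/
theorem withHighProb_forall_abs_error_sub_le {X Y : Type*} [MeasurableSpace X] [MeasurableSpace Y]
    {D : Measure (X × Y)} [IsProbabilityMeasure D] {H : Set (X → Bool)}
    (hHm : ∀ h ∈ H, Measurable h) (hH : TraceMeasurable H D.fst) {d : ℕ} (hd : vcDim H ≤ d)
    {L : Bool → Y → ℝ} (hL : ∀ a y, L a y ∈ Set.Icc (0 : ℝ) 1) (hLm : ∀ a, Measurable (L a))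
    {G : Set (X × Y)} (hG : MeasurableSet G) (hG0 : D G ≠ 0) (n : ℕ) {δ : ℝ} (hδ0 : 0 < δ)
    (hδ1 : δ < 1) :
    WithHighProb D n δ fun S => 1 ≤ groupSize S G →
      (δ ≤ 1 / 2 ∨ (1 ≤ d ∧ 2 ≤ groupSize S G)) → ∀ h ∈ H,
        |empError L S G h - condError L D G h| ≤
          8 * Real.sqrt ((Real.log (1 / δ) + d * Real.log (groupSize S G : ℝ)) /
            (groupSize S G : ℝ)) := by
  have : IsProbabilityMeasure (cond D G) := cond_isProbabilityMeasure hG0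
  have hex := fun J : Finset (Fin n) => exists_measurableSet_average_deviation (ι := J)
    (P := cond D G) hHm (hH.cond hG hG0) hd hL hLm hδ0 hδ1 (Fintype.card_coe J)
  choose B hBm hB hdev using hex
  obtain ⟨A, hA, hDA, hAB⟩ := exists_measurableSet_of_forall_groupIndices D hG hG0 B hBm hB
  refine ⟨Aᶜ, hA.compl, ?_, fun S hS h1 h2 h hh => ?_⟩
  · rw [prob_compl_eq_one_sub hA, ENNReal.ofReal_sub _ hδ0.le, ENNReal.ofReal_one]
    exact tsub_le_tsub_left hDA 1
  · have := hdev (groupIndices S G) _ (hAB S hS) h1 h2 h hh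
    rwa [Finset.sum_coe_sort (groupIndices S G) fun j => L (h (S j).1) (S j).2] at this

/-- The union bound over finitely many groups. -/
theorem WithHighProb.forall_fin {X Y : Type*} [MeasurableSpace X] [MeasurableSpace Y]
    {D : Measure (X × Y)} [IsProbabilityMeasure D] {n K : ℕ} (hK : 0 < K) {δ : ℝ} (hδ : 0 ≤ δ)
    {P : Fin K → (Fin n → X × Y) → Prop} (hP : ∀ i, WithHighProb D n (δ / K) (P i)) :
    WithHighProb D n δ fun S => ∀ i, P i S := by
  choose E hE hDE hEP using hP
  have hK0 : (0 : ℝ) < K := by exact_mod_cast hK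
  refine ⟨⋂ i, E i, MeasurableSet.iInter hE, ?_, fun S hS i => hEP i S (Set.mem_iInter.1 hS i)⟩
  have hcompl : (Measure.pi fun _ => D) (⋂ i, E i)ᶜ ≤ ENNReal.ofReal δ := by
    rw [Set.compl_iInter]
    refine (measure_iUnion_fintype_le _ _).trans ?_
    calc _ ≤ ∑ _i : Fin K, ENNReal.ofReal (δ / K) := Finset.sum_le_sum fun i _ => by
          rw [prob_compl_eq_one_sub (hE i), tsub_le_iff_right]
          calc (1 : ENNReal) = ENNReal.ofReal (δ / K + (1 - δ / K)) := by simp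
            _ ≤ ENNReal.ofReal (δ / K) + ENNReal.ofReal (1 - δ / K) := ENNReal.ofReal_add_le
            _ ≤ _ := by gcongr; exact hDE i
      _ = ENNReal.ofReal δ := by
        rw [Finset.sum_const, Finset.card_univ, Fintype.card_fin, nsmul_eq_mul,
          ← ENNReal.ofReal_natCast, ← ENNReal.ofReal_mul hK0.le, mul_div_cancel₀ _ hK0.ne']
  have h := prob_compl_eq_one_sub (μ := Measure.pi fun _ : Fin n => D)
    (MeasurableSet.iInter hE).compl
  rw [compl_compl] at h
  rw [h, ENNReal.ofReal_sub _ hδ, ENNReal.ofReal_one]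
  exact tsub_le_tsub_left hcompl 1

/-! ### Errors of randomized models -/

theorem empError_mem_Icc {X Y : Type*} {L : Bool → Y → ℝ}
    (hL : ∀ a y, L a y ∈ Set.Icc (0 : ℝ) 1) {n : ℕ} (S : Fin n → X × Y) (G : Set (X × Y))
    (h : X → Bool) : empError L S G h ∈ Set.Icc (0 : ℝ) 1 := by
  have h0 : 0 ≤ ∑ j ∈ groupIndices S G, L (h (S j).1) (S j).2 :=
    Finset.sum_nonneg fun j _ => (hL _ _).1
  have h1 : ∑ j ∈ groupIndices S G, L (h (S j).1) (S j).2 ≤ groupSize S G := by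
    refine (Finset.sum_le_sum fun j _ => (hL _ _).2).trans_eq ?_
    simp [groupSize]
  refine ⟨mul_nonneg (by positivity) h0, ?_⟩
  -- For an empty group the quotient is 0/0 = 0, so no positivity of the size is needed.
  rw [empError, one_div_mul_eq_div]
  exact div_le_one_of_le₀ h1 (Nat.cast_nonneg _)

theorem condError_mem_Icc {X Y : Type*} [MeasurableSpace X] [MeasurableSpace Y] {L : Bool → Y → ℝ}
    (hL : ∀ a y, L a y ∈ Set.Icc (0 : ℝ) 1) {D : Measure (X × Y)} [IsProbabilityMeasure D]
    {G : Set (X × Y)} (hG0 : D G ≠ 0) (h : X → Bool) :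
    condError L D G h ∈ Set.Icc (0 : ℝ) 1 := by
  have : IsProbabilityMeasure (cond D G) := cond_isProbabilityMeasure hG0
  refine ⟨integral_nonneg fun p => (hL _ _).1, ?_⟩
  refine (integral_mono_of_nonneg (ae_of_all _ fun p => (hL _ _).1) (integrable_const 1)
    (ae_of_all _ fun p => (hL _ _).2)).trans_eq ?_
  simp

namespace RandomizedModel

variable {X Y : Type*} [MeasurableSpace X] {H : Set (X → Bool)}

theorem measurable_toReal_mass (q : RandomizedModel H) (ν : Measure X) [hν : IsFiniteMeasure ν] :
    @Measurable H ℝ q.sigma _ fun h : H => (ν {x | h.1 x = true}).toReal := by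
  let := q.sigma
  exact (q.measurable_mass ν hν).ennreal_toReal

/-- Each loss is affine in the indicator of h(x) = 1, which is the mass that the Dirac measure at x
gives to the positive region of h. -/
theorem measurable_empError (hHm : ∀ h ∈ H, Measurable h) (q : RandomizedModel H)
    (L : Bool → Y → ℝ) {n : ℕ} (S : Fin n → X × Y) (G : Set (X × Y)) :
    @Measurable H ℝ q.sigma _ fun h : H => GroupFair.empError L S G h.1 := by
  let := q.sigma
  refine (Finset.measurable_sum _ fun j _ => ?_).const_mul _
  have key : (fun h : H => L (h.1 (S j).1) (S j).2) = fun h : H =>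
      L false (S j).2 + (L true (S j).2 - L false (S j).2) *
        (Measure.dirac (S j).1 {x | h.1 x = true}).toReal := by
    funext h
    have hm : MeasurableSet {x | h.1 x = true} := hHm h.1 h.2 (measurableSet_singleton true)
    rw [Measure.dirac_apply' _ hm]
    cases hx : h.1 (S j).1 <;> simp [hx]
  rw [key]
  exact ((q.measurable_toReal_mass _).const_mul _).const_add _

/-- The expected error as a combination of masses of the positive region of the model. -/
theorem integral_loss_eq [MeasurableSpace Y] {P : Measure (X × Y)} [IsFiniteMeasure P] {L : Bool → Y → ℝ}
    (hL : ∀ a y, L a y ∈ Set.Icc (0 : ℝ) 1) (hLm : ∀ a, Measurable (L a)) {h : X → Bool}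
    (hh : Measurable h) :
    ∫ p, L (h p.1) p.2 ∂P = ∫ p, L false p.2 ∂P +
      (((P.withDensity fun p => ENNReal.ofReal (L true p.2)).fst {x | h x = true}).toReal -
        ((P.withDensity fun p => ENNReal.ofReal (L false p.2)).fst {x | h x = true}).toReal) := by
  have hm : MeasurableSet {x | h x = true} := hh (measurableSet_singleton true)
  have hm' : MeasurableSet (Prod.fst ⁻¹' {x | h x = true} : Set (X × Y)) := measurable_fst hm
  have hLs : ∀ a, Measurable fun p : X × Y => L a p.2 := fun a => (hLm a).comp measurable_snd
  have hint : ∀ a, Integrable (fun p : X × Y => L a p.2) P := fun a =>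
    Integrable.of_bound (hLs a).aestronglyMeasurable 1 (ae_of_all _ fun p => by
      rw [Real.norm_eq_abs, abs_of_nonneg (hL _ _).1]; exact (hL _ _).2)
  have hmass : ∀ a, ((P.withDensity fun p => ENNReal.ofReal (L a p.2)).fst
      {x | h x = true}).toReal =
      ∫ p, (Prod.fst ⁻¹' {x | h x = true} : Set (X × Y)).indicator (fun p => L a p.2) p ∂P := by
    intro a
    rw [Measure.fst_apply hm, withDensity_apply _ hm', integral_indicator hm',
      integral_eq_lintegral_of_nonneg_ae (ae_of_all _ fun p => (hL _ _).1)
        (hLs a).aestronglyMeasurable]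
  rw [hmass, hmass, ← integral_sub ((hint _).indicator hm') ((hint _).indicator hm')]
  refine Eq.trans ?_
    (integral_add (hint _) (((hint true).indicator hm').sub ((hint false).indicator hm')))
  congr 1
  funext p
  cases hp : h p.1 <;> simp [hp]

/-- The densities L(1,·) and L(0,·) are bounded by 1, so they define finite measures, and the error
is affine in the masses that these give to the positive region. -/
theorem measurable_condError [MeasurableSpace Y] (hHm : ∀ h ∈ H, Measurable h) (q : RandomizedModel H)
    {L : Bool → Y → ℝ} (hL : ∀ a y, L a y ∈ Set.Icc (0 : ℝ) 1) (hLm : ∀ a, Measurable (L a))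
    {D : Measure (X × Y)} [IsProbabilityMeasure D] {G : Set (X × Y)} (hG0 : D G ≠ 0) :
    @Measurable H ℝ q.sigma _ fun h : H => GroupFair.condError L D G h.1 := by
  let := q.sigma
  have : IsProbabilityMeasure (cond D G) := cond_isProbabilityMeasure hG0
  have hfin : ∀ a, IsFiniteMeasure
      ((cond D G).withDensity fun p => ENNReal.ofReal (L a p.2)) := fun a => by
    refine isFiniteMeasure_withDensity (ne_of_lt (lt_of_le_of_lt
      (lintegral_mono (g := fun _ => 1) fun p => ?_) (by simp)))
    exact ENNReal.ofReal_le_one.2 (hL _ _).2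
  have key : (fun h : H => GroupFair.condError L D G h.1) = fun h : H => _ :=
    funext fun h => integral_loss_eq (P := cond D G) hL hLm (hHm h.1 h.2)
  rw [key]
  have h1 := hfin true
  have h2 := hfin false
  exact ((q.measurable_toReal_mass _).sub (q.measurable_toReal_mass _)).const_add _

theorem abs_error_sub_le [MeasurableSpace Y] (hHm : ∀ h ∈ H, Measurable h) (q : RandomizedModel H)
    {L : Bool → Y → ℝ} (hL : ∀ a y, L a y ∈ Set.Icc (0 : ℝ) 1) (hLm : ∀ a, Measurable (L a))
    {D : Measure (X × Y)} [IsProbabilityMeasure D] {G : Set (X × Y)} (hG0 : D G ≠ 0) {n : ℕ}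
    {S : Fin n → X × Y} {ε : ℝ}
    (hε : ∀ h ∈ H, |GroupFair.empError L S G h - GroupFair.condError L D G h| ≤ ε) :
    |q.empError L S G - q.condError L D G| ≤ ε := by
  let := q.sigma
  have := q.isProb
  have hbdd : ∀ {x : ℝ}, x ∈ Set.Icc (0 : ℝ) 1 → ‖x‖ ≤ 1 := fun hx => by
    rw [Real.norm_eq_abs, abs_of_nonneg hx.1]; exact hx.2
  have h1 : Integrable (fun h : H => GroupFair.empError L S G h.1) q.law :=
    Integrable.of_bound (q.measurable_empError hHm L S G).aestronglyMeasurable 1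
      (ae_of_all _ fun h => hbdd (empError_mem_Icc hL S G h.1))
  have h2 : Integrable (fun h : H => GroupFair.condError L D G h.1) q.law :=
    Integrable.of_bound (q.measurable_condError hHm hL hLm hG0).aestronglyMeasurable 1
      (ae_of_all _ fun h => hbdd (condError_mem_Icc hL hG0 h.1))
  rw [RandomizedModel.empError, RandomizedModel.condError, ← integral_sub h1 h2,
    ← Real.norm_eq_abs]
  refine (norm_integral_le_of_norm_le_const (ae_of_all _ fun h => hε h.1 h.2)).trans_eq ?_
  simp

/-- A deterministic model as a randomized model. -/
noncomputable def pure (h : H) : RandomizedModel H where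
  sigma := ⊤
  law := @Measure.dirac H ⊤ h
  isProb := @Measure.dirac.isProbabilityMeasure H ⊤ h
  measurable_mass _ _ := measurable_from_top

theorem empError_nonneg (q : RandomizedModel H) {L : Bool → Y → ℝ}
    (hL : ∀ a y, L a y ∈ Set.Icc (0 : ℝ) 1) {n : ℕ} (S : Fin n → X × Y) (G : Set (X × Y)) :
    0 ≤ q.empError L S G := by
  let := q.sigma
  exact integral_nonneg fun h => (empError_mem_Icc hL S G h.1).1

theorem condError_nonneg [MeasurableSpace Y] (q : RandomizedModel H) {L : Bool → Y → ℝ}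
    (hL : ∀ a y, L a y ∈ Set.Icc (0 : ℝ) 1) (D : Measure (X × Y)) (G : Set (X × Y)) :
    0 ≤ q.condError L D G := by
  let := q.sigma
  exact integral_nonneg fun _ => integral_nonneg fun _ => (hL _ _).1

end RandomizedModel

/-! ### From uniform bounds to minimax values -/

theorem abs_ciSup_sub_ciSup_le {ι : Type*} [Finite ι] [Nonempty ι] {a b : ι → ℝ} {ε : ℝ}
    (h : ∀ i, |a i - b i| ≤ ε) : |(⨆ i, a i) - ⨆ i, b i| ≤ ε := by
  have key : ∀ {a b : ι → ℝ}, (∀ i, |a i - b i| ≤ ε) → (⨆ i, a i) ≤ (⨆ i, b i) + ε :=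
    fun {a b} h => ciSup_le fun i => by
      have h1 := le_ciSup (Set.finite_range b).bddAbove i
      linarith [(abs_le.1 (h i)).2]
  have h1 := key h
  have h2 := key (a := b) (b := a) fun i => by rw [abs_sub_comm]; exact h i
  rw [abs_le]
  constructor <;> linarith

theorem abs_ciInf_sub_ciInf_le {ι : Type*} [Nonempty ι] {a b : ι → ℝ} {ε : ℝ}
    (ha : BddBelow (Set.range a)) (hb : BddBelow (Set.range b))
    (h : ∀ i, |a i - b i| ≤ ε) : |(⨅ i, a i) - ⨅ i, b i| ≤ ε := by
  have h1 : (⨅ i, a i) - ε ≤ ⨅ i, b i := le_ciInf fun i => by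
    linarith [ciInf_le ha i, (abs_le.1 (h i)).2]
  have h2 : (⨅ i, b i) - ε ≤ ⨅ i, a i := le_ciInf fun i => by
    linarith [ciInf_le hb i, (abs_le.1 (h i)).1]
  rw [abs_le]
  constructor <;> linarith

end GroupFair

theorem mainTheorem3 :
    ∃ C : ℝ, 0 < C ∧
      ∀ (X : Type*) (Y : Type*) [MeasurableSpace X] [MeasurableSpace Y]
        (D : Measure (X × Y)) [IsProbabilityMeasure D]
        (H : Set (X → Bool)) (d : ℕ) (L : Bool → Y → ℝ)
        (K : ℕ) (G : Fin K → Set (X × Y)) (n : ℕ) (δ : ℝ),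
        H.Nonempty →
        (∀ h ∈ H, Measurable h) →
        GroupFair.TraceMeasurable H D.fst →
        GroupFair.vcDim H = (d : ℕ∞) →
        (∀ a y, L a y ∈ Set.Icc (0 : ℝ) 1) →
        (∀ a, Measurable (L a)) →
        0 < K →
        (∀ i, MeasurableSet (G i)) →
        (∀ i, D (G i) ≠ 0) →
        0 < δ → δ < 1 →
        -- each group: uniform convergence over deterministic and randomized models
        (∀ i : Fin K, GroupFair.WithHighProb D n δ fun S =>
          1 ≤ GroupFair.groupSize S (G i) →
          (δ ≤ 1 / 2 ∨ (1 ≤ d ∧ 2 ≤ GroupFair.groupSize S (G i))) →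
          (∀ h ∈ H,
            |GroupFair.empError L S (G i) h - GroupFair.condError L D (G i) h| ≤
              C * Real.sqrt ((Real.log (1 / δ) +
                  d * Real.log (GroupFair.groupSize S (G i) : ℝ)) /
                (GroupFair.groupSize S (G i) : ℝ))) ∧
          (∀ q : GroupFair.RandomizedModel H,
            |q.empError L S (G i) - q.condError L D (G i)| ≤
              C * Real.sqrt ((Real.log (1 / δ) +
                  d * Real.log (GroupFair.groupSize S (G i) : ℝ)) /
                (GroupFair.groupSize S (G i) : ℝ)))) ∧
        -- all groups: the gap between the in-sample and out-of-sample minimax errors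
        (GroupFair.WithHighProb D n δ fun S =>
          (∀ i, 1 ≤ GroupFair.groupSize S (G i)) →
          (δ ≤ K / 2 ∨ (1 ≤ d ∧ ∀ i, 2 ≤ GroupFair.groupSize S (G i))) →
          (∀ q : GroupFair.RandomizedModel H,
            |(⨆ i, q.empError L S (G i)) - (⨆ i, q.condError L D (G i))| ≤
              C * ⨆ i, Real.sqrt ((Real.log (K / δ) +
                  d * Real.log (GroupFair.groupSize S (G i) : ℝ)) /
                (GroupFair.groupSize S (G i) : ℝ))) ∧
          |GroupFair.empMinimax H L S G - GroupFair.condMinimax H L D G| ≤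
            C * ⨆ i, Real.sqrt ((Real.log (K / δ) +
                d * Real.log (GroupFair.groupSize S (G i) : ℝ)) /
              (GroupFair.groupSize S (G i) : ℝ))) := by
  refine ⟨8, by norm_num, ?_⟩
  intro X Y _ _ D _ H d L K G n δ hne hHm hH hd hL hLm hK hG hG0 hδ0 hδ1
  have hK1 : (1 : ℝ) ≤ K := by exact_mod_cast hK
  have hKpos : (0 : ℝ) < K := by linarith
  have : Nonempty (Fin K) := ⟨⟨0, hK⟩⟩
  refine ⟨fun i => ?_, ?_⟩
  · obtain ⟨E, hE, hDE, hEP⟩ := GroupFair.withHighProb_forall_abs_error_sub_le hHm hH hd.le hL hLm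
      (hG i) (hG0 i) n hδ0 hδ1
    refine ⟨E, hE, hDE, fun S hS h1 h2 => ?_⟩
    have hdev := hEP S hS h1 h2
    exact ⟨hdev, fun q => q.abs_error_sub_le hHm hL hLm (hG0 i) hdev⟩
  -- Confidence δ/K per group produces log(K/δ) and turns the per-group condition δ/K ≤ 1/2 into δ ≤
  -- K/2.
  · obtain ⟨E, hE, hDE, hEP⟩ := GroupFair.WithHighProb.forall_fin hK hδ0.le fun i =>
      GroupFair.withHighProb_forall_abs_error_sub_le hHm hH hd.le hL hLm (hG i) (hG0 i) n
        (div_pos hδ0 hKpos) ((div_lt_one hKpos).2 (hδ1.trans_le hK1))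
    refine ⟨E, hE, hDE, fun S hS h1 h2 => ?_⟩
    have hdev : ∀ (q : GroupFair.RandomizedModel H) (i : Fin K),
        |q.empError L S (G i) - q.condError L D (G i)| ≤
          8 * ⨆ i, Real.sqrt ((Real.log (K / δ) +
            d * Real.log (GroupFair.groupSize S (G i) : ℝ)) /
              (GroupFair.groupSize S (G i) : ℝ)) := by
      intro q i
      have hor : δ / K ≤ 1 / 2 ∨ (1 ≤ d ∧ 2 ≤ GroupFair.groupSize S (G i)) :=
        h2.imp (fun h => by rw [div_le_iff₀ hKpos]; linarith) fun h => ⟨h.1, h.2 i⟩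
      have hi := q.abs_error_sub_le hHm hL hLm (hG0 i) (hEP S hS i (h1 i) hor)
      rw [one_div_div] at hi
      refine hi.trans (mul_le_mul_of_nonneg_left ?_ (by norm_num))
      exact le_ciSup (f := fun i => Real.sqrt ((Real.log (K / δ) +
        d * Real.log (GroupFair.groupSize S (G i) : ℝ)) / (GroupFair.groupSize S (G i) : ℝ)))
        (Set.finite_range _).bddAbove i
    have hsup := fun q => GroupFair.abs_ciSup_sub_ciSup_le (hdev q)
    have : Nonempty (GroupFair.RandomizedModel H) :=
      hne.elim fun h hh => ⟨GroupFair.RandomizedModel.pure ⟨h, hh⟩⟩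
    -- The bound is uniform in q, so it survives the infimum; nonnegativity of the errors keeps both
    -- real infima from defaulting to 0.
    refine ⟨hsup, GroupFair.abs_ciInf_sub_ciInf_le ⟨0, ?_⟩ ⟨0, ?_⟩ hsup⟩
    · rintro _ ⟨q, rfl⟩
      exact Real.iSup_nonneg fun i => q.empError_nonneg hL S (G i)
    · rintro _ ⟨q, rfl⟩
      exact Real.iSup_nonneg fun i => q.condError_nonneg hL D (G i)
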